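/- Let $K\in\{1,-1\}$, $d\ge 0$, and let $\mathbb{M}_K$ be the unit sphere $\{x : \langle x,x\rangle_K=1\}\subset\mathbb{R}\times\mathbb{R}^d$ if $K=1$, and hyperbolic space, the upper sheet $\{x=(t,z) : \langle x,x\rangle_K=-1,\ t>0\}\subset\mathbb{R}\times\mathbb{R}^d$ of the hyperboloid, if $K=-1$, where $\langle (s,z),(t,w)\rangle_K = K\,st+\langle z,w\rangle$; $\mathbb{M}_K$ carries the Riemannian metric induced by $\langle\cdot,\cdot\rangle_K$. Let $x_0\in\mathbb{M}_K$, let $e_1,\dots,e_d$ be an orthonormal basis of $T_{x_0}\mathbb{M}_K$, let $R\ge 0$, with $R<\pi/2$ if $K=1$, and let $\mathcal{M}=\operatorname{Exp}_{x_0}(\bar B(0,R))$. Let $h$ be the central projection $h(x)=\left(\frac{\langle e_i,x\rangle_K}{K\langle x_0,x\rangle_K}\right)_{i=1}^d$, that is, the gnomonic projection of the open hemisphere centred at $x_0$ onto $\mathbb{R}^d$ if $K=1$, and the Beltrami--Klein projection of hyperbolic space onto the open unit ball of $\mathbb{R}^d$ if $K=-1$; $h(x_0)=0$. Write $\tilde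 x=h(x)$. Let $F$ be a real function that is defined on a neighbourhood of $\mathcal{M}$ in $\mathbb{M}_K$ (in the domain of $h$) and differentiable at every point of $\mathcal{M}$, let $\nabla F$ be its Riemannian gradient, and let $f=F\circ h^{-1}$. Put $$\gamma_p=\cosh^{-3}(R),\quad \gamma_n=\cosh^{-2}(R)\quad\text{if } K=-1,\qquad \gamma_p=\cos^{2}(R),\quad \gamma_n=\cos^{3}(R)\quad\text{if } K=1.$$ Then $\gamma_p,\gamma_n\in(0,1]$, $f$ is differentiable at every point of $h(\mathcal{M})$, and for all $x,y\in\mathcal{M}$ with $\langle\nabla f(\tilde x),\tilde y-\tilde x\rangle\ne 0$, $$\gamma_p\le\frac{\langle\nabla F(x),\operatorname{Exp}_x^{-1}(y)\rangle_K}{\langle\nabla f(\tilde x),\tilde y-\tilde x\rangle}\le\frac1{\gamma_n}.$$ Moreover, if $F$ is g-convex on $\mathcal{M}$, that is, $F(y)\ge F(x)+\langle\nabla F(x),\operatorname{Exp}_x^{-1}(y)\rangle_K$ for all $x,y\in\mathcal{M}$, then for all $x,y\in\mathcal{M}$ $$f(\tilde x)+\frac1{\gamma_n}\langle\nabla f(\tilde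 x),\tilde y-\tilde x\rangle\le f(\tilde y)\quad\text{if }\langle\nabla f(\tilde x),\tilde y-\tilde x\rangle\le 0,$$ $$f(\tilde x)+\gamma_p\langle\nabla f(\tilde x),\tilde y-\tilde x\rangle\le f(\tilde y)\quad\text{if }\langle\nabla f(\tilde x),\tilde y-\tilde x\rangle\ge 0.$$ -/

import Mathlib

/-! The two model spaces of constant curvature `K ∈ {1, -1}` inside `ℝ × ℝ^d`: the unit sphere
(`K = 1`) and the upper sheet of the hyperboloid (`K = -1`), with the Riemannian metric induced
by the form `K s t + ⟪z, w⟫`; their exponential maps, gradients and central projections. -/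

namespace SpaceForm

abbrev Ambient (d : ℕ) : Type := ℝ × EuclideanSpace ℝ (Fin d)

/-- Euclidean inner product for `K = 1`, Minkowski form for `K = -1`. -/
noncomputable def form {d : ℕ} (K : ℝ) (u v : Ambient d) : ℝ :=
  K * (u.1 * v.1) + inner ℝ u.2 v.2

/-- The continuous linear functional `v ↦ form K u v`. -/
noncomputable def formCLM {d : ℕ} (K : ℝ) (u : Ambient d) : Ambient d →L[ℝ] ℝ :=
  (K * u.1) • ContinuousLinearMap.fst ℝ ℝ (EuclideanSpace ℝ (Fin d)) +
    (innerSL ℝ u.2).comp (ContinuousLinearMap.snd ℝ ℝ (EuclideanSpace ℝ (Fin d)))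

/-- The unit sphere of `ℝ^(d+1)` for `K = 1`, hyperbolic space (upper sheet of the hyperboloid)
for `K = -1`. -/
def space (K : ℝ) (d : ℕ) : Set (Ambient d) :=
  {x | form K x x = K ∧ (K < 0 → 0 < x.1)}

/-- `v` lies in the tangent space of `space K d` at `x`. -/
def IsTangent {d : ℕ} (K : ℝ) (x v : Ambient d) : Prop := form K x v = 0

/-- Norm of a tangent vector in the induced Riemannian metric. -/
noncomputable def tnorm {d : ℕ} (K : ℝ) (v : Ambient d) : ℝ := √(form K v v)

/-- The special cosine: `cos` for `K = 1`, `cosh` for `K = -1`. -/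
noncomputable def cosK (K t : ℝ) : ℝ := if K < 0 then Real.cosh t else Real.cos t

/-- The special sine: `sin` for `K = 1`, `sinh` for `K = -1`. -/
noncomputable def sinK (K t : ℝ) : ℝ := if K < 0 then Real.sinh t else Real.sin t

/-- The Riemannian distance of the model space. -/
noncomputable def distK {d : ℕ} (K : ℝ) (x y : Ambient d) : ℝ :=
  if K < 0 then Real.arcosh (-form K x y) else Real.arccos (form K x y)

/-- The exponential map at `x`, on vectors `v` tangent at `x`. See `deriv_deriv_expMap`: the curves
`t ↦ expMap K x (t • v)` are the geodesics through `x`. -/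
noncomputable def expMap {d : ℕ} (K : ℝ) (x v : Ambient d) : Ambient d :=
  cosK K (tnorm K v) • x + (sinK K (tnorm K v) / tnorm K v) • v

/-- The inverse exponential map at `x`; see `logMap_spec`. -/
noncomputable def logMap {d : ℕ} (K : ℝ) (x y : Ambient d) : Ambient d :=
  (distK K x y / sinK K (distK K x y)) • (y - cosK K (distK K x y) • x)

/-- The closed geodesic ball `Exp_{x₀}(B̄(0, R))`. -/
def closedBall {d : ℕ} (K : ℝ) (x₀ : Ambient d) (R : ℝ) : Set (Ambient d) :=
  expMap K x₀ '' {v | IsTangent K x₀ v ∧ tnorm K v ≤ R}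

/-- `g` is the Riemannian gradient at `x` of the restriction of `F` to the model space: it is
tangent at `x` and represents, through the metric, the differential of `F` along the space. -/
def HasGradAt {d : ℕ} (K : ℝ) (F : Ambient d → ℝ) (g x : Ambient d) : Prop :=
  IsTangent K x g ∧ HasFDerivWithinAt F (formCLM K g) (space K d) x

open Classical in
/-- The Riemannian gradient at `x` of the restriction of `F` to the model space (`0` if there is
none). -/
noncomputable def grad {d : ℕ} (K : ℝ) (F : Ambient d → ℝ) (x : Ambient d) : Ambient d :=
  if h : ∃ g, HasGradAt K F g x then h.choose else 0

/-- First-order geodesic convexity of `F` on `M`. -/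
def GConvexOn {d : ℕ} (K : ℝ) (M : Set (Ambient d)) (F : Ambient d → ℝ) : Prop :=
  ∀ x ∈ M, ∀ y ∈ M, F x + form K (grad K F x) (logMap K x y) ≤ F y

/-- `e` is an orthonormal basis of the tangent space at `x₀`. -/
def IsFrame {d : ℕ} (K : ℝ) (x₀ : Ambient d) (e : Fin d → Ambient d) : Prop :=
  (∀ i, IsTangent K x₀ (e i)) ∧ ∀ i j, form K (e i) (e j) = if i = j then 1 else 0

/-- The central projection onto the affine tangent space at `x₀`, in the coordinates given by the
frame `e`: the gnomonic projection for `K = 1` (on the open hemisphere centred at `x₀`), the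
Beltrami-Klein projection for `K = -1`. It maps `x₀` to `0`. -/
noncomputable def geodesicMap {d : ℕ} (K : ℝ) (x₀ : Ambient d) (e : Fin d → Ambient d)
    (x : Ambient d) : EuclideanSpace ℝ (Fin d) :=
  WithLp.toLp 2 fun i => form K (e i) x / (K * form K x₀ x)

/-- The inverse of `geodesicMap`, on `ℝ^d` for `K = 1` and on the open unit ball for `K = -1`. -/
noncomputable def geodesicMapInv {d : ℕ} (K : ℝ) (x₀ : Ambient d) (e : Fin d → Ambient d)
    (u : EuclideanSpace ℝ (Fin d)) : Ambient d :=
  (1 / √(1 + K * ‖u‖ ^ 2)) • (x₀ + ∑ i, u i • e i)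

/-- `cos² R` for `K = 1`, `cosh⁻³ R` for `K = -1`. -/
noncomputable def gammaP (K R : ℝ) : ℝ :=
  if K < 0 then 1 / Real.cosh R ^ 3 else Real.cos R ^ 2

/-- `cos³ R` for `K = 1`, `cosh⁻² R` for `K = -1`. -/
noncomputable def gammaN (K R : ℝ) : ℝ :=
  if K < 0 then 1 / Real.cosh R ^ 2 else Real.cos R ^ 3

/-! Sanity facts: the objects above are well defined. -/

section Facts

variable {d : ℕ} {K : ℝ}

theorem formCLM_apply (u v : Ambient d) : formCLM K u v = form K u v := by
  simp [formCLM, form, mul_assoc]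

theorem form_comm (u v : Ambient d) : form K u v = form K v u := by
  simp only [form, real_inner_comm u.2 v.2]; ring

theorem form_add_right (u v w : Ambient d) : form K u (v + w) = form K u v + form K u w := by
  simp only [← formCLM_apply, map_add]

theorem form_sub_right (u v w : Ambient d) : form K u (v - w) = form K u v - form K u w := by
  simp only [← formCLM_apply, map_sub]

theorem form_smul_right (a : ℝ) (u v : Ambient d) : form K u (a • v) = a * form K u v := by
  simp only [← formCLM_apply, map_smul, smul_eq_mul]

theorem form_sum_right {ι : Type*} (s : Finset ι) (u : Ambient d) (v : ι → Ambient d) :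
    form K u (∑ i ∈ s, v i) = ∑ i ∈ s, form K u (v i) := by
  simp only [← formCLM_apply, map_sum]

theorem form_add_left (u v w : Ambient d) : form K (u + v) w = form K u w + form K v w := by
  rw [form_comm, form_add_right, form_comm w u, form_comm w v]

theorem form_sub_left (u v w : Ambient d) : form K (u - v) w = form K u w - form K v w := by
  rw [form_comm, form_sub_right, form_comm w u, form_comm w v]

theorem form_smul_left (a : ℝ) (u v : Ambient d) : form K (a • u) v = a * form K u v := by
  rw [form_comm, form_smul_right, form_comm]

theorem form_self (v : Ambient d) : form K v v = K * v.1 ^ 2 + ‖v.2‖ ^ 2 := by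
  simp only [form, real_inner_self_eq_norm_sq]; ring

/-- The metric is positive definite on tangent spaces. -/
theorem form_pos_of_isTangent (hK : K = 1 ∨ K = -1) {x v : Ambient d} (hx : x ∈ space K d)
    (hv : IsTangent K x v) (hne : v ≠ 0) : 0 < form K v v := by
  have h0 : v.1 ≠ 0 ∨ v.2 ≠ 0 := by
    by_contra! h
    exact hne (Prod.ext h.1 h.2)
  rcases hK with rfl | rfl
  · rw [form_self]
    rcases h0 with h | h
    · have := sq_pos_of_ne_zero h
      positivity
    · have := norm_pos_iff.2 h
      positivity
  · have h1 := hx.1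
    rw [form_self] at h1 ⊢
    have hv' : x.1 * v.1 = inner ℝ x.2 v.2 := by
      have : form (-1) x v = 0 := hv
      simp only [form] at this; linarith
    have hcs := abs_real_inner_le_norm x.2 v.2
    have hsq : (x.1 * v.1) ^ 2 ≤ (‖x.2‖ * ‖v.2‖) ^ 2 := by
      rw [hv', ← sq_abs]; gcongr
    have hx1 := hx.2 (by norm_num)
    have hx1' : x.1 ^ 2 = 1 + ‖x.2‖ ^ 2 := by linarith
    have hv2 : 0 < ‖v.2‖ := by
      rcases h0 with h | h
      · by_contra hn
        have hz : ‖v.2‖ = 0 := le_antisymm (not_lt.1 hn) (norm_nonneg _)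
        have : 0 < (x.1 * v.1) ^ 2 := by positivity
        rw [hz] at hsq; nlinarith
      · exact norm_pos_iff.2 h
    have h2 : 0 < x.1 ^ 2 * (-1 * v.1 ^ 2 + ‖v.2‖ ^ 2) := by
      have : 0 < ‖v.2‖ ^ 2 := by positivity
      nlinarith
    exact pos_of_mul_pos_right h2 (by positivity)

theorem form_nonneg_of_isTangent (hK : K = 1 ∨ K = -1) {x v : Ambient d} (hx : x ∈ space K d)
    (hv : IsTangent K x v) : 0 ≤ form K v v := by
  by_cases h : v = 0
  · subst h; simp [form]
  · exact (form_pos_of_isTangent hK hx hv h).le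

theorem cosK_sq_add (hK : K = 1 ∨ K = -1) (t : ℝ) : cosK K t ^ 2 + K * sinK K t ^ 2 = 1 := by
  rcases hK with rfl | rfl
  · simp [cosK, sinK, show ¬ ((1 : ℝ) < 0) by norm_num]
  · simp only [cosK, sinK, show ((-1 : ℝ) < 0) by norm_num, if_true]
    nlinarith [Real.cosh_sq t]

/-- Along a tangent direction the exponential map has this closed form. -/
theorem expMap_smul (hK : K = 1 ∨ K = -1) {x v : Ambient d} (hx : x ∈ space K d)
    (hv : IsTangent K x v) (hne : v ≠ 0) (t : ℝ) :
    expMap K x (t • v) =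
      cosK K (tnorm K v * t) • x + (sinK K (tnorm K v * t) / tnorm K v) • v := by
  have hc : 0 < tnorm K v := Real.sqrt_pos.2 (form_pos_of_isTangent hK hx hv hne)
  have hn : tnorm K (t • v) = |t| * tnorm K v := by
    rw [tnorm, form_smul_left, form_smul_right, ← mul_assoc, Real.sqrt_mul (mul_self_nonneg t),
      Real.sqrt_mul_self_eq_abs, tnorm]
  rw [expMap, hn]
  rcases eq_or_ne t 0 with rfl | ht
  · simp [sinK]
  congr 1
  · congr 1
    rcases abs_choice t with h | h <;> rw [h] <;> simp [cosK, mul_comm]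
  · rw [smul_smul]
    congr 1
    rcases abs_choice t with h | h <;> rw [h]
    · rw [mul_comm t]; field_simp
    · have : sinK K (-t * tnorm K v) = - sinK K (tnorm K v * t) := by
        unfold sinK
        split_ifs <;> simp [mul_comm]
      rw [this]; field_simp

theorem hasDerivAt_cosK (hK : K = 1 ∨ K = -1) (t : ℝ) :
    HasDerivAt (cosK K) (-K * sinK K t) t := by
  rcases hK with rfl | rfl
  · have h : ¬ ((1 : ℝ) < 0) := by norm_num
    have h1 : cosK 1 = Real.cos := by funext s; simp [cosK, h]
    rw [h1]; simpa [sinK, h] using Real.hasDerivAt_cos t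
  · have h : ((-1 : ℝ) < 0) := by norm_num
    have h1 : cosK (-1) = Real.cosh := by funext s; simp [cosK]
    rw [h1]; simpa [sinK, h] using Real.hasDerivAt_cosh t

theorem hasDerivAt_sinK (hK : K = 1 ∨ K = -1) (t : ℝ) :
    HasDerivAt (sinK K) (cosK K t) t := by
  rcases hK with rfl | rfl
  · have h : ¬ ((1 : ℝ) < 0) := by norm_num
    have h1 : sinK 1 = Real.sin := by funext s; simp [sinK, h]
    rw [h1]; simpa [cosK, h] using Real.hasDerivAt_sin t
  · have h : ((-1 : ℝ) < 0) := by norm_num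
    have h1 : sinK (-1) = Real.sinh := by funext s; simp [sinK]
    rw [h1]; simpa [cosK, h] using Real.hasDerivAt_sinh t

/-- The exponential map takes values in the space. -/
theorem expMap_mem (hK : K = 1 ∨ K = -1) {x v : Ambient d} (hx : x ∈ space K d)
    (hv : IsTangent K x v) : expMap K x v ∈ space K d := by
  rcases eq_or_ne v 0 with rfl | hne
  · have : expMap K x 0 = x := by simp [expMap, tnorm, form, cosK]
    rwa [this]
  have hpos := form_pos_of_isTangent hK hx hv hne
  have hc : 0 < tnorm K v := Real.sqrt_pos.2 hpos
  have hcs : form K v v = tnorm K v ^ 2 := (Real.sq_sqrt hpos.le).symm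
  have hxv : form K x v = 0 := hv
  have hself : form K (expMap K x v) (expMap K x v) = K := by
    have hcK := cosK_sq_add hK (tnorm K v)
    simp only [expMap, form_add_left, form_add_right, form_smul_left, form_smul_right,
      form_comm v x, hxv, hx.1, hcs]
    have hKK : K * K = 1 := by rcases hK with rfl | rfl <;> norm_num
    have hq : sinK K (tnorm K v) / tnorm K v * (sinK K (tnorm K v) / tnorm K v * tnorm K v ^ 2) =
        sinK K (tnorm K v) ^ 2 := by field_simp
    linear_combination K * hcK - sinK K (tnorm K v) ^ 2 * hKK + hq
  refine ⟨hself, fun hneg => ?_⟩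
  obtain rfl : K = -1 := by
    rcases hK with rfl | h
    · norm_num at hneg
    · exact h
  have hx1 := hx.2 hneg
  have h1 := hx.1
  rw [form_self] at h1
  have hv' : x.1 * v.1 = inner ℝ x.2 v.2 := by
    simp only [form] at hxv; linarith
  have hcs' := abs_real_inner_le_norm x.2 v.2
  rw [form_self] at hcs
  set c := tnorm (-1) v
  have hvx : |v.1| ≤ x.1 * c := by
    apply abs_le_of_sq_le_sq _ (by positivity)
    have hsq : (x.1 * v.1) ^ 2 ≤ (‖x.2‖ * ‖v.2‖) ^ 2 := by
      rw [hv', ← sq_abs]; gcongr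
    nlinarith
  have hsh : Real.sinh c < Real.cosh c := Real.sinh_lt_cosh c
  have hsp : 0 < Real.sinh c := Real.sinh_pos_iff.2 hc
  have h2 := (abs_le.1 hvx).1
  have hfst : (expMap (-1) x v).1 = Real.cosh c * x.1 + Real.sinh c / c * v.1 := by
    simp [expMap, cosK, sinK, c]
  rw [hfst]
  have h3 : Real.sinh c / c * (-(x.1 * c)) ≤ Real.sinh c / c * v.1 := by gcongr
  have h4 : Real.sinh c / c * (-(x.1 * c)) = - (Real.sinh c * x.1) := by field_simp
  nlinarith

/-- `t ↦ expMap K x (t • v)` has initial velocity `v`. -/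
theorem hasDerivAt_expMap_zero (hK : K = 1 ∨ K = -1) {x v : Ambient d} (hx : x ∈ space K d)
    (hv : IsTangent K x v) : HasDerivAt (fun t : ℝ => expMap K x (t • v)) v 0 := by
  rcases eq_or_ne v 0 with rfl | hne
  · simpa using hasDerivAt_const (0 : ℝ) (expMap K x 0)
  have hc : tnorm K v ≠ 0 := (Real.sqrt_pos.2 (form_pos_of_isTangent hK hx hv hne)).ne'
  have hl : HasDerivAt (fun t : ℝ => tnorm K v * t) (tnorm K v) 0 := by
    simpa using (hasDerivAt_id (0 : ℝ)).const_mul (tnorm K v)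
  have h1 := ((hasDerivAt_cosK hK (tnorm K v * 0)).comp 0 hl).smul_const x
  have h2 := (((hasDerivAt_sinK hK (tnorm K v * 0)).comp 0 hl).div_const (tnorm K v)).smul_const v
  rw [funext (expMap_smul hK hx hv hne)]
  have hs0 : sinK K 0 = 0 := by simp [sinK]
  have hc0 : cosK K 0 = 1 := by simp [cosK]
  have h3 := h1.add h2
  simp only [mul_zero, hs0, hc0, zero_mul, zero_smul, zero_add, one_mul, div_self hc,
    one_smul] at h3
  exact h3

/-- The geodesic equation: the acceleration of `t ↦ expMap K x (t • v)` is normal to the space,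
so that its tangential part, the covariant acceleration, vanishes. -/
theorem deriv_deriv_expMap (hK : K = 1 ∨ K = -1) {x v : Ambient d} (hx : x ∈ space K d)
    (hv : IsTangent K x v) (t : ℝ) :
    deriv (deriv fun s : ℝ => expMap K x (s • v)) t =
      (-(K * form K v v)) • expMap K x (t • v) := by
  rcases eq_or_ne v 0 with rfl | hne
  · simp [form]
  have hpos := form_pos_of_isTangent hK hx hv hne
  have hc : tnorm K v ≠ 0 := (Real.sqrt_pos.2 hpos).ne'
  have hcs : form K v v = tnorm K v ^ 2 := (Real.sq_sqrt hpos.le).symm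
  have hl : ∀ t : ℝ, HasDerivAt (fun t : ℝ => tnorm K v * t) (tnorm K v) t := fun t => by
    simpa using (hasDerivAt_id t).const_mul (tnorm K v)
  have h1 : ∀ t, HasDerivAt (fun t => cosK K (tnorm K v * t))
      (-K * sinK K (tnorm K v * t) * tnorm K v) t := fun t =>
    (hasDerivAt_cosK hK (tnorm K v * t)).comp t (hl t)
  have h2 : ∀ t, HasDerivAt (fun t => sinK K (tnorm K v * t))
      (cosK K (tnorm K v * t) * tnorm K v) t := fun t =>
    (hasDerivAt_sinK hK (tnorm K v * t)).comp t (hl t)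
  have hd : (deriv fun s : ℝ => expMap K x (s • v)) = fun t =>
      (-K * sinK K (tnorm K v * t) * tnorm K v) • x +
        (cosK K (tnorm K v * t) * tnorm K v / tnorm K v) • v := by
    funext t
    rw [funext (expMap_smul hK hx hv hne)]
    exact (((h1 t).smul_const x).add (((h2 t).div_const _).smul_const v)).deriv
  rw [hd, expMap_smul hK hx hv hne t]
  have h3 := (((((h2 t).const_mul (-K)).mul_const (tnorm K v)).smul_const x).add
    ((((h1 t).mul_const (tnorm K v)).div_const (tnorm K v)).smul_const v)).deriv
  refine h3.trans ?_
  rw [smul_add, smul_smul, smul_smul, hcs]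
  congr 2
  · ring
  · field_simp

/-- On the hyperboloid `-form` is at least `1`; on the sphere `|form|` is at most `1`. -/
theorem cosK_distK (hK : K = 1 ∨ K = -1) {x y : Ambient d} (hx : x ∈ space K d)
    (hy : y ∈ space K d) : cosK K (distK K x y) = K * form K x y := by
  have hx1 := hx.1
  have hy1 := hy.1
  rw [form_self] at hx1 hy1
  have hcs := abs_le.1 (abs_real_inner_le_norm x.2 y.2)
  rcases hK with rfl | rfl
  · have h : ¬ ((1 : ℝ) < 0) := by norm_num
    simp only [cosK, distK, h, if_false, one_mul]
    have hb : |form 1 x y| ≤ 1 := by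
      simp only [form]
      rw [abs_le]
      constructor <;>
        nlinarith [sq_nonneg (x.1 + y.1), sq_nonneg (x.1 - y.1), sq_nonneg (‖x.2‖ - ‖y.2‖)]
    exact Real.cos_arccos (abs_le.1 hb).1 (abs_le.1 hb).2
  · have h : ((-1 : ℝ) < 0) := by norm_num
    have hx0 := hx.2 h
    have hy0 := hy.2 h
    simp only [cosK, distK, h, if_true]
    rw [Real.cosh_arcosh]
    · ring
    · simp only [form]
      have : (1 + ‖x.2‖ * ‖y.2‖) ≤ x.1 * y.1 := by
        apply le_of_sq_le_sq _ (by positivity)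
        have : (x.1 * y.1) ^ 2 = (1 + ‖x.2‖ ^ 2) * (1 + ‖y.2‖ ^ 2) := by
          rw [mul_pow]; congr 1 <;> linarith
        rw [this]
        nlinarith [sq_nonneg (‖x.2‖ - ‖y.2‖)]
      linarith [hcs.2]

/-- `logMap K x y` is the tangent vector at `x`, of length `distK K x y`, that the exponential map
sends to `y` (for `y` not antipodal to `x` when `K = 1`). -/
theorem logMap_spec (hK : K = 1 ∨ K = -1) {x y : Ambient d} (hx : x ∈ space K d)
    (hy : y ∈ space K d) (hxy : K = 1 → y ≠ -x) :
    IsTangent K x (logMap K x y) ∧ tnorm K (logMap K x y) = distK K x y ∧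
      expMap K x (logMap K x y) = y := by
  have hC := cosK_distK hK hx hy
  have hKK : K * K = 1 := by rcases hK with rfl | rfl <;> norm_num
  have hcs := cosK_sq_add hK (distK K x y)
  have hs0 : 0 ≤ sinK K (distK K x y) := by
    rcases hK with rfl | rfl
    · have h : ¬ ((1 : ℝ) < 0) := by norm_num
      simp only [sinK, distK, h, if_false]
      exact Real.sin_nonneg_of_nonneg_of_le_pi (Real.arccos_nonneg _) (Real.arccos_le_pi _)
    · have h : ((-1 : ℝ) < 0) := by norm_num
      have hb := Real.one_le_cosh (distK (-1) x y)
      simp only [cosK, h, if_true] at hC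
      simp only [sinK, h, if_true, Real.sinh_nonneg_iff]
      simp only [distK, h, if_true]
      exact Real.arcosh_nonneg (by linarith)
  have hD0 : 0 ≤ distK K x y := by
    rcases hK with rfl | rfl
    · have h : ¬ ((1 : ℝ) < 0) := by norm_num
      simp only [distK, h, if_false]
      exact Real.arccos_nonneg _
    · have h : ((-1 : ℝ) < 0) := by norm_num
      simpa only [sinK, h, if_true, Real.sinh_nonneg_iff] using hs0
  have hform : form K x y = K * cosK K (distK K x y) := by
    rw [hC, ← mul_assoc, hKK, one_mul]
  set D := distK K x y with hD
  set C := cosK K D with hCdef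
  set s := sinK K D with hs
  have hxw : form K x (y - C • x) = 0 := by
    rw [form_sub_right, form_smul_right, hx.1, hform]; ring
  have hww : form K (y - C • x) (y - C • x) = s ^ 2 := by
    rw [form_sub_left, form_smul_left, hxw, form_sub_right, form_smul_right, form_comm y x, hy.1,
      hform]
    linear_combination (-K) * hcs + s ^ 2 * hKK
  rcases hs0.eq_or_lt with hz | hpos
  · have hw : y - C • x = 0 := by
      by_contra hne
      have := form_pos_of_isTangent hK hx hxw hne
      rw [hww, ← hz] at this
      norm_num at this
    have hy' : y = C • x := sub_eq_zero.1 hw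
    have hC2 : C ^ 2 = 1 := by rw [← hz] at hcs; linarith
    have hC1 : C = 1 := by
      rcases sq_eq_sq_iff_eq_or_eq_neg.1 (hC2.trans (one_pow 2).symm) with h | h
      · exact h
      · exfalso
        rcases hK with rfl | rfl
        · exact hxy rfl (by rw [hy', h]; simp)
        · have h' : ((-1 : ℝ) < 0) := by norm_num
          have := Real.cosh_pos D
          simp only [hCdef, cosK, h', if_true] at h
          linarith
    have hDz : D = 0 := by
      rw [hC1, mul_one] at hform
      rcases hK with rfl | rfl <;> simp [hD, distK, hform]
    have hl : logMap K x y = 0 := by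
      rw [logMap, ← hD, ← hCdef, hw, smul_zero]
    rw [hl, hDz]
    refine ⟨by simp [IsTangent, form], by simp [tnorm, form], ?_⟩
    rw [hy', hC1]
    simp [expMap, tnorm, form, cosK]
  · have hDne : D ≠ 0 := by
      intro h
      rw [hs, h] at hpos
      simp [sinK] at hpos
    have hl : logMap K x y = (D / s) • (y - C • x) := rfl
    have hn : tnorm K (logMap K x y) = D := by
      rw [hl, tnorm, form_smul_left, form_smul_right, hww,
        show D / s * (D / s * s ^ 2) = D ^ 2 by field_simp, Real.sqrt_sq hD0]
    refine ⟨?_, hn, ?_⟩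
    · rw [IsTangent, hl, form_smul_right, hxw, mul_zero]
    · rw [expMap, hn, ← hs, ← hCdef, hl, smul_smul, show s / D * (D / s) = 1 by field_simp]
      simp

/-- A function differentiable at `x` along the space has a gradient there. -/
theorem hasGradAt_grad (hK : K = 1 ∨ K = -1) {F : Ambient d → ℝ} {x : Ambient d}
    (hx : x ∈ space K d) (hF : DifferentiableWithinAt ℝ F (space K d) x) :
    HasGradAt K F (grad K F x) x := by
  have hKK : K * K = 1 := by rcases hK with rfl | rfl <;> norm_num
  have key : ∃ g, HasGradAt K F g x := by
    obtain ⟨L, hL⟩ := hF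
    let ℓ : StrongDual ℝ (EuclideanSpace ℝ (Fin d)) :=
      L.comp (ContinuousLinearMap.inr ℝ ℝ (EuclideanSpace ℝ (Fin d)))
    let g₀ : Ambient d := (K * L (1, 0), (InnerProductSpace.toDual ℝ _).symm ℓ)
    have hg₀ : ∀ v, form K g₀ v = L v := by
      intro v
      have h1 : L v = v.1 * L (1, 0) + L (0, v.2) := by
        rw [← smul_eq_mul, ← map_smul, ← map_add]
        congr 1
        ext <;> simp
      have h2 : inner ℝ ((InnerProductSpace.toDual ℝ _).symm ℓ) v.2 = L (0, v.2) := by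
        rw [InnerProductSpace.toDual_symm_apply]; simp [ℓ]
      rw [h1]
      simp only [form, g₀, h2]
      linear_combination (L (1, 0) * v.1) * hKK
    refine ⟨g₀ - (K * form K g₀ x) • x, ?_, ?_⟩
    · rw [IsTangent, form_sub_right, form_smul_right, hx.1, form_comm x]
      linear_combination (- form K g₀ x) * hKK
    · have hQ : HasFDerivAt (fun y : Ambient d => form K y y) ((2 : ℝ) • formCLM K x) x := by
        have h1 : HasFDerivAt (fun y : Ambient d => y.1) (ContinuousLinearMap.fst ℝ ℝ _) x :=
          hasFDerivAt_fst
        have h2 : HasFDerivAt (fun y : Ambient d => y.2) (ContinuousLinearMap.snd ℝ ℝ _) x :=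
          hasFDerivAt_snd
        have h3 := ((h1.mul h1).const_mul K).add (h2.inner ℝ h2)
        refine h3.congr_fderiv ?_
        ext v <;> simp [formCLM, real_inner_comm] <;> ring
      have h4 := hL.sub ((hQ.const_mul (K * form K g₀ x / 2)).hasFDerivWithinAt (s := space K d))
      have h5 := h4.add_const (K * form K g₀ x / 2 * K)
      refine (h5.congr_fderiv ?_).congr ?_ ?_
      · refine ContinuousLinearMap.ext fun v => ?_
        simp only [sub_apply, smul_apply, formCLM_apply,
          form_sub_left, form_smul_left, hg₀, smul_eq_mul]
        ring
      · intro y hy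
        simp [hy.1]
      · simp [hx.1]
  rw [grad, dif_pos key]
  exact key.choose_spec

/-- The gradient is unique. -/
theorem HasGradAt.unique (hK : K = 1 ∨ K = -1) {F : Ambient d → ℝ} {g g' x : Ambient d}
    (hx : x ∈ space K d) (hg : HasGradAt K F g x) (hg' : HasGradAt K F g' x) : g = g' := by
  have hT : IsTangent K x (g - g') := by
    have h1 : form K x g = 0 := hg.1
    have h2 : form K x g' = 0 := hg'.1
    rw [IsTangent, form_sub_right, h1, h2, sub_zero]
  have h0 : expMap K x ((0 : ℝ) • (g - g')) = x := by
    simp [expMap, tnorm, form, cosK]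
  have hγ := hasDerivAt_expMap_zero hK hx hT
  have hmem : ∀ t : ℝ, expMap K x (t • (g - g')) ∈ space K d := fun t =>
    expMap_mem hK hx (by
      have h3 : form K x (g - g') = 0 := hT
      rw [IsTangent, form_smul_right, h3, mul_zero])
  have hd : ∀ u, HasGradAt K F u x →
      HasDerivAt (fun t : ℝ => F (expMap K x (t • (g - g')))) (form K u (g - g')) 0 := by
    intro u hu
    have h4 := hu.2
    rw [← h0] at h4
    have h5 := h4.comp_hasDerivWithinAt (s := Set.univ) (0 : ℝ) hγ.hasDerivWithinAt
      (fun t _ => hmem t)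
    rw [hasDerivWithinAt_univ, formCLM_apply] at h5
    exact h5
  have heq := (hd g hg).unique (hd g' hg')
  by_contra hne
  have hpos := form_pos_of_isTangent hK hx hT (sub_ne_zero.2 hne)
  rw [form_sub_left, heq, sub_self] at hpos
  exact lt_irrefl _ hpos

theorem form_eq_zero_of_frame (hK : K = 1 ∨ K = -1) {x₀ w : Ambient d} {e : Fin d → Ambient d}
    (hx₀ : x₀ ∈ space K d) (he : IsFrame K x₀ e) (h0 : form K x₀ w = 0)
    (h1 : ∀ i, form K (e i) w = 0) : w = 0 := by
  by_contra hne
  have hK0 : K ≠ 0 := by rcases hK with rfl | rfl <;> norm_num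
  have hpos := form_pos_of_isTangent hK hx₀ h0 hne
  let b : Option (Option (Fin d)) → Ambient d
    | none => w
    | some none => x₀
    | some (some i) => e i
  have horth : ∀ i j, i ≠ j → form K (b i) (b j) = 0 := by
    have h2 : ∀ i, form K x₀ (e i) = 0 := he.1
    rintro (_ | _ | i) (_ | _ | j) hij <;>
      simp_all [b, form_comm w, form_comm (e _) x₀, he.2]
  have hnz : ∀ i, form K (b i) (b i) ≠ 0 := by
    rintro (_ | _ | i)
    · exact hpos.ne'
    · simpa [b, hx₀.1] using hK0
    · simp [b, he.2]
  have hli : LinearIndependent ℝ b := by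
    rw [Fintype.linearIndependent_iff]
    intro c hc i
    have h3 : form K (b i) (∑ j, c j • b j) = 0 := by rw [hc]; simp [form]
    rw [form_sum_right, Finset.sum_eq_single i] at h3
    · rw [form_smul_right] at h3
      exact (mul_eq_zero.1 h3).resolve_right (hnz i)
    · intro j _ hj
      rw [form_smul_right, horth i j hj.symm, mul_zero]
    · simp
  have hcard := hli.fintype_card_le_finrank
  simp [Module.finrank_prod] at hcard
  omega

theorem form_lift {x₀ : Ambient d}
    {e : Fin d → Ambient d} (hx₀ : x₀ ∈ space K d) (he : IsFrame K x₀ e)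
    (u : EuclideanSpace ℝ (Fin d)) :
    form K x₀ (x₀ + ∑ i, u i • e i) = K ∧ (∀ i, form K (e i) (x₀ + ∑ i, u i • e i) = u i) ∧
      form K (x₀ + ∑ i, u i • e i) (x₀ + ∑ i, u i • e i) = K + ‖u‖ ^ 2 := by
  have h2 : ∀ i, form K x₀ (e i) = 0 := he.1
  have ha : form K x₀ (x₀ + ∑ i, u i • e i) = K := by
    simp [form_add_right, form_sum_right, form_smul_right, h2, hx₀.1]
  have hb : ∀ i, form K (e i) (x₀ + ∑ i, u i • e i) = u i := by
    intro i
    simp [form_add_right, form_sum_right, form_smul_right, form_comm (e i) x₀, h2, he.2]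
  refine ⟨ha, hb, ?_⟩
  rw [form_add_left, ha, form_comm, form_sum_right]
  simp only [form_smul_right, form_comm _ (e _), hb]
  rw [EuclideanSpace.norm_sq_eq]
  simp [sq]

/-- `geodesicMapInv` is a left inverse of `geodesicMap` on the open hemisphere centred at `x₀`
(`K = 1`), respectively on the whole hyperbolic space. -/
theorem geodesicMapInv_geodesicMap (hK : K = 1 ∨ K = -1) {x₀ x : Ambient d}
    {e : Fin d → Ambient d} (hx₀ : x₀ ∈ space K d) (he : IsFrame K x₀ e) (hx : x ∈ space K d)
    (hpos : 0 < K * form K x₀ x) :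
    geodesicMapInv K x₀ e (geodesicMap K x₀ e x) = x := by
  have hKK : K * K = 1 := by rcases hK with rfl | rfl <;> norm_num
  set u := geodesicMap K x₀ e x with hu
  obtain ⟨ha, hb, hc⟩ := form_lift hx₀ he u
  have hui : ∀ i, u i = form K (e i) x / (K * form K x₀ x) := fun i => rfl
  have hlift : x₀ + ∑ i, u i • e i = (1 / (K * form K x₀ x)) • x := by
    rw [← sub_eq_zero]
    refine form_eq_zero_of_frame hK hx₀ he ?_ fun i => ?_
    · rw [form_sub_right, ha, form_smul_right]
      have : form K x₀ x ≠ 0 := fun h => by simp [h] at hpos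
      have hK0 : K ≠ 0 := fun h => by simp [h] at hpos
      field_simp
      linear_combination hKK
    · rw [form_sub_right, hb, form_smul_right, hui]; ring
  rw [hlift, form_smul_left, form_smul_right, hx.1] at hc
  have hn : 1 + K * ‖u‖ ^ 2 = (1 / (K * form K x₀ x)) ^ 2 := by
    linear_combination (-K) * hc + ((1 / (K * form K x₀ x)) ^ 2 - 1) * hKK
  rw [geodesicMapInv, hn, hlift, Real.sqrt_sq (by positivity), smul_smul]
  have : K * form K x₀ x ≠ 0 := hpos.ne'
  rw [show 1 / (1 / (K * form K x₀ x)) * (1 / (K * form K x₀ x)) = 1 by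
    rw [one_div_one_div, mul_one_div, div_self this], one_smul]

/-- `geodesicMapInv` is a right inverse of `geodesicMap` on `ℝ^d` (`K = 1`), respectively on the
open unit ball (`K = -1`). -/
theorem geodesicMap_geodesicMapInv (hK : K = 1 ∨ K = -1) {x₀ : Ambient d}
    {e : Fin d → Ambient d} (hx₀ : x₀ ∈ space K d) (he : IsFrame K x₀ e)
    {u : EuclideanSpace ℝ (Fin d)} (hu : 0 < 1 + K * ‖u‖ ^ 2) :
    geodesicMap K x₀ e (geodesicMapInv K x₀ e u) = u := by
  have hKK : K * K = 1 := by rcases hK with rfl | rfl <;> norm_num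
  obtain ⟨ha, hb, -⟩ := form_lift hx₀ he u
  ext i
  have hs : √(1 + K * ‖u‖ ^ 2) ≠ 0 := (Real.sqrt_pos.2 hu).ne'
  have : (geodesicMap K x₀ e (geodesicMapInv K x₀ e u)) i =
      form K (e i) (geodesicMapInv K x₀ e u) / (K * form K x₀ (geodesicMapInv K x₀ e u)) := rfl
  rw [this, geodesicMapInv, form_smul_right, form_smul_right, ha, hb, mul_left_comm, hKK]
  field_simp

end Facts

end SpaceForm

namespace SpaceForm

/-! ### Elementary bounds on `t / sin t` and `t / sinh t` -/

/-! Write a = K⟨x₀,x⟩, b = K⟨x₀,y⟩, D for the distance from x to y, and g = ∇F(x). Everything rests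
on the fact that g is orthogonal to x in the ambient form, so that both slopes are multiples of the
same number ⟨g,y⟩.

Upstairs, the inverse exponential is (D / sinK D)(y - cosK D · x), and the x-term is lost against g
(`form_logMap`). Downstairs, x/a is the point of the affine tangent space at x₀ with coordinates x̃.
The inverse chart is that affine point times a scalar; differentiating the scalar gives a multiple
of x, again killed by g. What remains is ⟨∇f(x̃), ỹ - x̃⟩ = a⟨g, y/b - x/a⟩ = (a/b)⟨g,y⟩
(`inner_gradient_comp_geodesicMapInv`). Hence the ratio of the slopes is (D / sinK D)(b/a),
independent of F.

Both factors are then estimated separately. In the ball, a and b are values of cosK on [0, R], which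
bounds b/a. The cosine law with Cauchy-Schwarz (`abs_form_sub_mul_le`) compares cosK D with cosK 2R,
in effect D ≤ 2R, and half-angle inequalities turn this into a bound on D / sinK D
(`distortion_sphere`, `distortion_hyperbolic`). The convexity inequalities follow by replacing the
ratio with whichever of its bounds suits the sign of the slope. -/

theorem sinh_le_mul_cosh {t : ℝ} (ht : 0 ≤ t) : Real.sinh t ≤ t * Real.cosh t := by
  have hd : ∀ s : ℝ, HasDerivAt (fun s => s * Real.cosh s - Real.sinh s) (s * Real.sinh s) s := by
    intro s
    refine (((hasDerivAt_id s).mul (Real.hasDerivAt_cosh s)).sub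
      (Real.hasDerivAt_sinh s)).congr_deriv ?_
    simp
  have hmono : MonotoneOn (fun s => s * Real.cosh s - Real.sinh s) (Set.Ici 0) := by
    refine monotoneOn_of_deriv_nonneg (convex_Ici 0)
      (fun s _ => (hd s).continuousAt.continuousWithinAt)
      (fun s _ => (hd s).differentiableAt.differentiableWithinAt) fun s hs => ?_
    rw [interior_Ici, Set.mem_Ioi] at hs
    rw [(hd s).deriv]
    exact mul_nonneg hs.le (Real.sinh_nonneg_iff.2 hs.le)
  have := hmono Set.self_mem_Ici ht ht
  simp only [zero_mul, Real.sinh_zero, sub_zero] at this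
  linarith

/-- Since 1 + cosh D = 2 cosh²(D/2) and sinh D = 2 sinh(D/2) cosh(D/2), the lower bound is tanh(D/2)
≤ D/2. The form in cosh D is chosen because the cosine law controls exactly that quantity. -/
theorem div_sinh_bounds {D : ℝ} (hD : 0 < D) :
    2 / (1 + Real.cosh D) ≤ D / Real.sinh D ∧ D / Real.sinh D ≤ 1 := by
  have hs : 0 < Real.sinh D := Real.sinh_pos_iff.2 hD
  have hc := Real.cosh_pos D
  constructor
  · rw [div_le_div_iff₀ (by positivity) hs]
    have h1 := sinh_le_mul_cosh (half_pos hD).le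
    have h2 := Real.sinh_two_mul (D / 2)
    have h3 := Real.cosh_two_mul (D / 2)
    have h4 := Real.cosh_sq (D / 2)
    rw [mul_div_cancel₀ D two_ne_zero] at h2 h3
    have h5 := mul_le_mul_of_nonneg_right h1 (Real.cosh_pos (D / 2)).le
    rw [h2, h3]
    linear_combination 4 * h5 + D * h4
  · rw [div_le_one hs]
    exact Real.self_le_sinh_iff.2 hD.le

/-- The half-angle argument again: the upper bound is D/2 ≤ tan(D/2), which needs D/2 < π/2. -/
theorem div_sin_bounds {D : ℝ} (hD : 0 < D) (hDpi : D < Real.pi) :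
    1 ≤ D / Real.sin D ∧ D / Real.sin D ≤ 2 / (1 + Real.cos D) := by
  have hs : 0 < Real.sin D := Real.sin_pos_of_pos_of_lt_pi hD hDpi
  have hch : 0 < Real.cos (D / 2) := Real.cos_pos_of_mem_Ioo ⟨by linarith, by linarith⟩
  have h2 := Real.sin_two_mul (D / 2)
  have h3 := Real.cos_two_mul (D / 2)
  rw [mul_div_cancel₀ D two_ne_zero] at h2 h3
  constructor
  · rw [one_le_div hs]
    exact Real.sin_le hD.le
  · rw [div_le_div_iff₀ hs (by rw [h3]; nlinarith)]
    have h1 := Real.le_tan (half_pos hD).le (by linarith)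
    rw [Real.tan_eq_sin_div_cos, le_div_iff₀ hch] at h1
    have h5 := mul_le_mul_of_nonneg_right h1 hch.le
    rw [h2, h3]
    linear_combination 4 * h5

section Chart

variable {d : ℕ} {K : ℝ} {x₀ x y : Ambient d} {e : Fin d → Ambient d}

/-! ### Geodesic balls -/

theorem mem_space_of_mem_closedBall (hK : K = 1 ∨ K = -1) (hx₀ : x₀ ∈ space K d) {R : ℝ}
    (hx : x ∈ closedBall K x₀ R) : x ∈ space K d := by
  obtain ⟨v, ⟨hv, -⟩, rfl⟩ := hx
  exact expMap_mem hK hx₀ hv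

/-- The initial velocity is orthogonal to x₀, so pairing the exponential with x₀ leaves only the
cosine of its length r. -/
theorem exists_form_eq_cosK_of_mem_closedBall (hK : K = 1 ∨ K = -1) (hx₀ : x₀ ∈ space K d)
    {R : ℝ} (hx : x ∈ closedBall K x₀ R) :
    ∃ r, 0 ≤ r ∧ r ≤ R ∧ K * form K x₀ x = cosK K r := by
  obtain ⟨v, ⟨hv, hr⟩, rfl⟩ := hx
  refine ⟨tnorm K v, Real.sqrt_nonneg _, hr, ?_⟩
  have h0 : form K x₀ v = 0 := hv
  have hKK : K * K = 1 := by rcases hK with rfl | rfl <;> norm_num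
  rw [expMap, form_add_right, form_smul_right, form_smul_right, hx₀.1, h0]
  linear_combination cosK K (tnorm K v) * hKK

theorem form_mem_Icc_of_mem_closedBall_sphere (hx₀ : x₀ ∈ space 1 d) {R : ℝ}
    (hR : R < Real.pi / 2) (hx : x ∈ closedBall 1 x₀ R) :
    Real.cos R ≤ 1 * form 1 x₀ x ∧ 1 * form 1 x₀ x ≤ 1 := by
  obtain ⟨r, h0, h1, h2⟩ := exists_form_eq_cosK_of_mem_closedBall (.inl rfl) hx₀ hx
  rw [h2, cosK, if_neg (by norm_num)]
  exact ⟨Real.cos_le_cos_of_nonneg_of_le_pi h0 (by linarith [Real.pi_pos]) h1, Real.cos_le_one r⟩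

theorem form_mem_Icc_of_mem_closedBall_hyperbolic (hx₀ : x₀ ∈ space (-1) d) {R : ℝ}
    (hx : x ∈ closedBall (-1) x₀ R) :
    1 ≤ -1 * form (-1) x₀ x ∧ -1 * form (-1) x₀ x ≤ Real.cosh R := by
  obtain ⟨r, h0, h1, h2⟩ := exists_form_eq_cosK_of_mem_closedBall (.inr rfl) hx₀ hx
  rw [h2, cosK, if_pos (by norm_num)]
  refine ⟨Real.one_le_cosh r, Real.cosh_le_cosh.2 ?_⟩
  rwa [abs_of_nonneg h0, abs_of_nonneg (h0.trans h1)]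

/-! ### The chart -/

/-- The point of the affine tangent space at `x₀` with coordinates `u`. -/
noncomputable def lift (x₀ : Ambient d) (e : Fin d → Ambient d) (u : EuclideanSpace ℝ (Fin d)) :
    Ambient d := x₀ + ∑ i, u i • e i

theorem lift_sub_lift (u v : EuclideanSpace ℝ (Fin d)) :
    lift x₀ e v - lift x₀ e u = ∑ i, (v - u) i • e i := by
  simp [lift, sub_smul]

theorem form_lift_lift (hx₀ : x₀ ∈ space K d) (he : IsFrame K x₀ e)
    (u v : EuclideanSpace ℝ (Fin d)) :
    form K (lift x₀ e u) (lift x₀ e v) = K + inner ℝ u v := by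
  obtain ⟨ha, hb, -⟩ := form_lift hx₀ he u
  rw [lift, lift, form_add_right, form_comm, ha, form_sum_right]
  simp only [form_smul_right, form_comm _ (e _), hb]
  simp [PiLp.inner_apply]

/-- The ray through a point of the space meets the affine tangent space at `x₀` in the lift of
its central projection. -/
theorem smul_lift_geodesicMap (hK : K = 1 ∨ K = -1) (hx₀ : x₀ ∈ space K d)
    (he : IsFrame K x₀ e) (hx : x ∈ space K d) (hpos : 0 < K * form K x₀ x) :
    (K * form K x₀ x) • lift x₀ e (geodesicMap K x₀ e x) = x ∧
      1 / √(1 + K * ‖geodesicMap K x₀ e x‖ ^ 2) = K * form K x₀ x := by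
  have hKK : K * K = 1 := by rcases hK with rfl | rfl <;> norm_num
  have hinv := geodesicMapInv_geodesicMap hK hx₀ he hx hpos
  rw [geodesicMapInv] at hinv
  -- The lift pairs with x₀ to K, so pairing the inversion formula with x₀ isolates the scale
  -- factor.
  have hφ : 1 / √(1 + K * ‖geodesicMap K x₀ e x‖ ^ 2) = K * form K x₀ x := by
    have h1 := congrArg (form K x₀) hinv
    rw [form_smul_right, (form_lift hx₀ he _).1] at h1
    rw [← h1]
    linear_combination (-(1 / √(1 + K * ‖geodesicMap K x₀ e x‖ ^ 2))) * hKK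
  exact ⟨by rw [← hφ]; exact hinv, hφ⟩

/-- Expanding ⟨x,x⟩ = K with x = a · lift gives a²(K + ‖x̃‖²) = K. Geometrically, a is cosK r and
a‖x̃‖ is sinK r, with r the distance to x₀. -/
theorem mul_norm_geodesicMap_sq (hK : K = 1 ∨ K = -1) (hx₀ : x₀ ∈ space K d)
    (he : IsFrame K x₀ e) (hx : x ∈ space K d) (hpos : 0 < K * form K x₀ x) :
    ((K * form K x₀ x) * ‖geodesicMap K x₀ e x‖) ^ 2 = K * (1 - (K * form K x₀ x) ^ 2) := by
  have h1 := (smul_lift_geodesicMap hK hx₀ he hx hpos).1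
  have h2 := hx.1
  set a := K * form K x₀ x
  rw [← h1, form_smul_left, form_smul_right, form_lift_lift hx₀ he,
    real_inner_self_eq_norm_sq] at h2
  linear_combination h2

/-- The cosine law, as an inequality. -/
theorem abs_form_sub_mul_le (hK : K = 1 ∨ K = -1) (hx₀ : x₀ ∈ space K d) (he : IsFrame K x₀ e)
    (hx : x ∈ space K d) (hy : y ∈ space K d) (hxpos : 0 < K * form K x₀ x)
    (hypos : 0 < K * form K x₀ y) {c : ℝ}
    (hxc : K * (1 - (K * form K x₀ x) ^ 2) ≤ c) (hyc : K * (1 - (K * form K x₀ y) ^ 2) ≤ c) :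
    |K * form K x y - (K * form K x₀ x) * (K * form K x₀ y)| ≤ c := by
  have hKK : K * K = 1 := by rcases hK with rfl | rfl <;> norm_num
  have hK1 : |K| = 1 := by rcases hK with rfl | rfl <;> norm_num
  have hx1 := (smul_lift_geodesicMap hK hx₀ he hx hxpos).1
  have hy1 := (smul_lift_geodesicMap hK hx₀ he hy hypos).1
  rw [← mul_norm_geodesicMap_sq hK hx₀ he hx hxpos] at hxc
  rw [← mul_norm_geodesicMap_sq hK hx₀ he hy hypos] at hyc
  have hxy : form K x y = (K * form K x₀ x) * ((K * form K x₀ y) *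
      (K + inner ℝ (geodesicMap K x₀ e x) (geodesicMap K x₀ e y))) := by
    conv_lhs => rw [← hx1, ← hy1]
    rw [form_smul_left, form_smul_right, form_lift_lift hx₀ he]
  rw [hxy]
  set u := geodesicMap K x₀ e x
  set v := geodesicMap K x₀ e y
  set a := K * form K x₀ x
  set b := K * form K x₀ y
  -- The cosine law: the deviation from the product of cosines is the product of sines times the
  -- cosine of the angle at x₀, up to the sign K.
  have h1 : K * (a * (b * (K + inner ℝ u v))) - a * b = K * (a * b * inner ℝ u v) := by
    linear_combination a * b * hKK
  rw [h1, abs_mul, hK1, one_mul, abs_mul, abs_of_pos (mul_pos hxpos hypos)]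
  have h2 := mul_le_mul_of_nonneg_left (abs_real_inner_le_norm u v) (mul_pos hxpos hypos).le
  -- By the arithmetic-geometric mean inequality, 2(a‖u‖)(b‖v‖) ≤ (a‖u‖)² + (b‖v‖)² ≤ 2c.
  nlinarith [sq_nonneg (a * ‖u‖ - b * ‖v‖)]

/-! ### Differentiating along the chart -/

theorem hasFDerivAt_lift (u : EuclideanSpace ℝ (Fin d)) :
    ∃ L : EuclideanSpace ℝ (Fin d) →L[ℝ] Ambient d,
      (∀ w, L w = ∑ i, w i • e i) ∧ HasFDerivAt (lift x₀ e) L u := by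
  refine ⟨∑ i, (EuclideanSpace.proj i : EuclideanSpace ℝ (Fin d) →L[ℝ] ℝ).smulRight (e i),
    fun w => by simp, ?_⟩
  have h := ((∑ i, (EuclideanSpace.proj i : EuclideanSpace ℝ (Fin d) →L[ℝ] ℝ).smulRight
    (e i)).hasFDerivAt (x := u)).const_add x₀
  refine h.congr_of_eventuallyEq (.of_forall fun v => ?_)
  simp [lift]

theorem differentiableAt_scale {u : EuclideanSpace ℝ (Fin d)} (hu : 0 < 1 + K * ‖u‖ ^ 2) :
    DifferentiableAt ℝ (fun u : EuclideanSpace ℝ (Fin d) => 1 / √(1 + K * ‖u‖ ^ 2)) u := by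
  have h1 : DifferentiableAt ℝ (fun u : EuclideanSpace ℝ (Fin d) => 1 + K * ‖u‖ ^ 2) u :=
    (((differentiableAt_id).norm_sq ℝ).const_mul K).const_add 1
  simp only [one_div]
  exact (h1.sqrt hu.ne').inv (Real.sqrt_pos.2 hu).ne'

open Filter Topology in
/-- The differential of `F ∘ geodesicMapInv` in terms of the Riemannian gradient. -/
theorem hasFDerivAt_comp_geodesicMapInv (hK : K = 1 ∨ K = -1) (hx₀ : x₀ ∈ space K d)
    (he : IsFrame K x₀ e) (hx : x ∈ space K d) (hpos : 0 < K * form K x₀ x)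
    {F : Ambient d → ℝ} {g : Ambient d} (hg : HasGradAt K F g x) :
    ∃ L : EuclideanSpace ℝ (Fin d) →L[ℝ] ℝ,
      (∀ w, L w = (K * form K x₀ x) * form K g (∑ i, w i • e i)) ∧
        HasFDerivAt (F ∘ geodesicMapInv K x₀ e) L (geodesicMap K x₀ e x) := by
  obtain ⟨hsmul, hφ⟩ := smul_lift_geodesicMap hK hx₀ he hx hpos
  have hinv := geodesicMapInv_geodesicMap hK hx₀ he hx hpos
  set u := geodesicMap K x₀ e x
  set a := K * form K x₀ x
  have hu : 0 < 1 + K * ‖u‖ ^ 2 := by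
    rw [← hφ, one_div, inv_pos, Real.sqrt_pos] at hpos
    exact hpos
  obtain ⟨A, hA, hAd⟩ := hasFDerivAt_lift (x₀ := x₀) (e := e) u
  have hG := (differentiableAt_scale hu).hasFDerivAt.smul hAd
  set φ' := fderiv ℝ (fun u : EuclideanSpace ℝ (Fin d) => 1 / √(1 + K * ‖u‖ ^ 2)) u
  have hG' : HasFDerivAt (geodesicMapInv K x₀ e)
      ((1 / √(1 + K * ‖u‖ ^ 2)) • A + φ'.smulRight (lift x₀ e u)) u := hG
  -- `F` is differentiable only along the space. The inverse chart stays in the space near u, so the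
  -- derivative of the composite within the preimage is a full derivative.
  have hev : ∀ᶠ w in 𝓝 u, geodesicMapInv K x₀ e w ∈ space K d := by
    have hc : ContinuousAt (fun w : EuclideanSpace ℝ (Fin d) => 1 + K * ‖w‖ ^ 2) u := by fun_prop
    have h1 : ∀ᶠ w in 𝓝 u, 0 < 1 + K * ‖w‖ ^ 2 := hc.eventually (lt_mem_nhds hu)
    -- Staying on the upper sheet is an open condition, satisfied at u because the inverse chart
    -- returns x there.
    have h2 : ∀ᶠ w in 𝓝 u, K < 0 → 0 < (geodesicMapInv K x₀ e w).1 := by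
      by_cases hneg : K < 0
      · have h3 : ContinuousAt (fun w => (geodesicMapInv K x₀ e w).1) u :=
          continuous_fst.continuousAt.comp hG'.continuousAt
        have h4 : 0 < (geodesicMapInv K x₀ e u).1 := by rw [hinv]; exact hx.2 hneg
        exact (h3.eventually (lt_mem_nhds h4)).mono fun w hw _ => hw
      · exact .of_forall fun w h => absurd h hneg
    filter_upwards [h1, h2] with w hw1 hw2
    refine ⟨?_, hw2⟩
    have hKK : K * K = 1 := by rcases hK with rfl | rfl <;> norm_num
    rw [geodesicMapInv, form_smul_left, form_smul_right, (form_lift hx₀ he w).2.2, ← mul_assoc,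
      ← sq, div_pow, Real.sq_sqrt hw1.le]
    field_simp
    linear_combination (-‖w‖ ^ 2) * hKK
  have hF := hg.2
  rw [← hinv] at hF
  have hcomp := (hF.comp u (hG'.hasFDerivWithinAt (s := geodesicMapInv K x₀ e ⁻¹' space K d))
    (Set.mapsTo_preimage _ _)).hasFDerivAt hev
  refine ⟨_, fun w => ?_, hcomp⟩
  -- The lift is a positive multiple of x, hence orthogonal to g; this removes the derivative `φ'`
  -- of the scale factor.
  have hgl : form K g (lift x₀ e u) = 0 := by
    have h1 : form K x g = 0 := hg.1
    rw [← hsmul, form_smul_left, form_comm] at h1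
    exact (mul_eq_zero.1 h1).resolve_left hpos.ne'
  rw [ContinuousLinearMap.comp_apply, formCLM_apply, add_apply,
    smul_apply, ContinuousLinearMap.smulRight_apply, hA, hφ, form_add_right,
    form_smul_right, form_smul_right, hgl, mul_zero, add_zero]

/-- The slope of `F ∘ geodesicMapInv` between two points of the chart. -/
theorem inner_gradient_comp_geodesicMapInv (hK : K = 1 ∨ K = -1) (hx₀ : x₀ ∈ space K d)
    (he : IsFrame K x₀ e) (hx : x ∈ space K d) (hxpos : 0 < K * form K x₀ x)
    (hy : y ∈ space K d) (hypos : 0 < K * form K x₀ y)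
    {F : Ambient d → ℝ} {g : Ambient d} (hg : HasGradAt K F g x) :
    inner ℝ (gradient (F ∘ geodesicMapInv K x₀ e) (geodesicMap K x₀ e x))
        (geodesicMap K x₀ e y - geodesicMap K x₀ e x) =
      (K * form K x₀ x) / (K * form K x₀ y) * form K g y := by
  obtain ⟨L, hL, hLd⟩ := hasFDerivAt_comp_geodesicMapInv hK hx₀ he hx hxpos hg
  have hxs := (smul_lift_geodesicMap hK hx₀ he hx hxpos).1
  have hys := (smul_lift_geodesicMap hK hx₀ he hy hypos).1
  rw [gradient, InnerProductSpace.toDual_symm_apply, hLd.fderiv, hL, ← lift_sub_lift (x₀ := x₀),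
    form_sub_right]
  have hgx : form K g (lift x₀ e (geodesicMap K x₀ e x)) = 0 := by
    have h1 : form K x g = 0 := hg.1
    rw [← hxs, form_smul_left, form_comm _ g] at h1
    exact (mul_eq_zero.1 h1).resolve_left hxpos.ne'
  have hgy : form K g y = (K * form K x₀ y) * form K g (lift x₀ e (geodesicMap K x₀ e y)) := by
    conv_lhs => rw [← hys, form_smul_right]
  rw [hgx, hgy, sub_zero, ← mul_assoc, div_mul_cancel₀ _ hypos.ne']

/-- Tangency of g at x discards the component of the logarithm along x. -/
theorem form_logMap {g : Ambient d} (hg : IsTangent K x g) :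
    form K g (logMap K x y) = distK K x y / sinK K (distK K x y) * form K g y := by
  have h1 : form K x g = 0 := hg
  rw [logMap, form_smul_right, form_sub_right, form_smul_right, form_comm g x, h1]
  ring

theorem distK_nonneg (hK : K = 1 ∨ K = -1) (hx : x ∈ space K d) (hy : y ∈ space K d) :
    0 ≤ distK K x y := by
  rcases hK with rfl | rfl
  · rw [distK, if_neg (by norm_num)]
    exact Real.arccos_nonneg _
  · have h1 := cosK_distK (.inr rfl) hx hy
    rw [cosK, if_pos (by norm_num)] at h1
    have h2 := Real.one_le_cosh (distK (-1) x y)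
    rw [distK, if_pos (by norm_num)]
    exact Real.arcosh_nonneg (by linarith)

theorem eq_of_distK_eq_zero (hK : K = 1 ∨ K = -1) (hx : x ∈ space K d) (hy : y ∈ space K d)
    (h : distK K x y = 0) : y = x := by
  -- Antipodal points must be excluded before `logMap_spec` applies: for them the cosine of the
  -- distance is -1, not cos 0.
  have hne : K = 1 → y ≠ -x := by
    rintro rfl rfl
    have h1 := cosK_distK (.inl rfl) hx hy
    have h2 : form 1 x (-x) = -1 := by
      rw [← neg_one_smul ℝ x, form_smul_right, hx.1]; norm_num
    rw [h, h2] at h1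
    norm_num [cosK] at h1
  have h3 := (logMap_spec hK hx hy hne).2.2
  have h4 : logMap K x y = 0 := by rw [logMap, h, zero_div, zero_smul]
  rw [← h3, h4]
  simp [expMap, tnorm, form, cosK]

end Chart

/-! ### The distortion constants -/

theorem gammaP_mem_Ioc {K R : ℝ} (hK : K = 1 ∨ K = -1) (hR : 0 ≤ R)
    (hRK : K = 1 → R < Real.pi / 2) : 0 < gammaP K R ∧ gammaP K R ≤ 1 := by
  rcases hK with rfl | rfl
  · have hc : 0 < Real.cos R := Real.cos_pos_of_mem_Ioo ⟨by linarith [Real.pi_pos], hRK rfl⟩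
    rw [gammaP, if_neg (by norm_num)]
    exact ⟨by positivity, pow_le_one₀ hc.le (Real.cos_le_one R)⟩
  · have hc := Real.one_le_cosh R
    rw [gammaP, if_pos (by norm_num)]
    exact ⟨by positivity, (div_le_one (by positivity)).2 (one_le_pow₀ hc)⟩

theorem gammaN_mem_Ioc {K R : ℝ} (hK : K = 1 ∨ K = -1) (hR : 0 ≤ R)
    (hRK : K = 1 → R < Real.pi / 2) : 0 < gammaN K R ∧ gammaN K R ≤ 1 := by
  rcases hK with rfl | rfl
  · have hc : 0 < Real.cos R := Real.cos_pos_of_mem_Ioo ⟨by linarith [Real.pi_pos], hRK rfl⟩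
    rw [gammaN, if_neg (by norm_num)]
    exact ⟨by positivity, pow_le_one₀ hc.le (Real.cos_le_one R)⟩
  · have hc := Real.one_le_cosh R
    rw [gammaN, if_pos (by norm_num)]
    exact ⟨by positivity, (div_le_one (by positivity)).2 (one_le_pow₀ hc)⟩

/-! ### Bounds for the ratio of the two slopes -/

section Distortion

variable {d : ℕ} {K : ℝ} {x₀ x y : Ambient d} {e : Fin d → Ambient d}

theorem form_pos_of_mem_closedBall (hK : K = 1 ∨ K = -1) (hx₀ : x₀ ∈ space K d) {R : ℝ}
    (hR : 0 ≤ R) (hRK : K = 1 → R < Real.pi / 2) (hx : x ∈ closedBall K x₀ R) :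
    0 < K * form K x₀ x := by
  rcases hK with rfl | rfl
  · have hc : 0 < Real.cos R := Real.cos_pos_of_mem_Ioo ⟨by linarith [Real.pi_pos], hRK rfl⟩
    exact hc.trans_le (form_mem_Icc_of_mem_closedBall_sphere hx₀ (hRK rfl) hx).1
  · exact one_pos.trans_le (form_mem_Icc_of_mem_closedBall_hyperbolic hx₀ hx).1

/-- Both a and b lie in [cos R, 1], so b/a lies in [cos R, 1/cos R], while D / sin D lies in [1,
1/cos² R]. The product of the upper bounds is the source of the cube. -/
theorem distortion_sphere (hx₀ : x₀ ∈ space 1 d) (he : IsFrame 1 x₀ e) {R : ℝ} (hR : 0 ≤ R)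
    (hR2 : R < Real.pi / 2) (hx : x ∈ closedBall 1 x₀ R) (hy : y ∈ closedBall 1 x₀ R)
    (hD : 0 < distK 1 x y) :
    Real.cos R ^ 2 ≤
        distK 1 x y / Real.sin (distK 1 x y) * ((1 * form 1 x₀ y) / (1 * form 1 x₀ x)) ∧
      distK 1 x y / Real.sin (distK 1 x y) * ((1 * form 1 x₀ y) / (1 * form 1 x₀ x)) ≤
        1 / Real.cos R ^ 3 := by
  have hK : (1 : ℝ) = 1 ∨ (1 : ℝ) = -1 := .inl rfl
  have hc : 0 < Real.cos R := Real.cos_pos_of_mem_Ioo ⟨by linarith [Real.pi_pos], hR2⟩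
  have hc1 := Real.cos_le_one R
  have hxs := mem_space_of_mem_closedBall hK hx₀ hx
  have hys := mem_space_of_mem_closedBall hK hx₀ hy
  obtain ⟨ha1, ha2⟩ := form_mem_Icc_of_mem_closedBall_sphere hx₀ hR2 hx
  obtain ⟨hb1, hb2⟩ := form_mem_Icc_of_mem_closedBall_sphere hx₀ hR2 hy
  have hcos := cosK_distK hK hxs hys
  rw [cosK, if_neg (by norm_num)] at hcos
  -- The constant c is sin² R, which bounds 1 - a² and 1 - b².
  have habs := abs_form_sub_mul_le (c := 1 - Real.cos R ^ 2) hK hx₀ he hxs hys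
    (hc.trans_le ha1) (hc.trans_le hb1) (by nlinarith) (by nlinarith)
  rw [← hcos] at habs
  have hDle : distK 1 x y ≤ Real.pi := by
    rw [distK, if_neg (by norm_num)]
    exact Real.arccos_le_pi _
  set a := 1 * form 1 x₀ x
  set b := 1 * form 1 x₀ y
  set D := distK 1 x y
  -- From cos D ≥ ab - sin² R ≥ 2cos² R - 1 = cos 2R. In particular cos D > -1, so x and y are not
  -- antipodal.
  have hcosD : 2 * Real.cos R ^ 2 ≤ 1 + Real.cos D := by
    nlinarith [(abs_le.1 habs).1, mul_le_mul ha1 hb1 hc.le (hc.le.trans ha1)]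
  have hDpi : D < Real.pi := by
    refine lt_of_le_of_ne hDle fun h => ?_
    rw [h, Real.cos_pi] at hcosD
    nlinarith
  obtain ⟨h1, h2⟩ := div_sin_bounds hD hDpi
  have hba1 : Real.cos R ≤ b / a := by
    rw [le_div_iff₀ (hc.trans_le ha1)]; nlinarith
  have hba2 : b / a ≤ 1 / Real.cos R :=
    div_le_div₀ zero_le_one hb2 hc ha1
  have h3 : D / Real.sin D ≤ 1 / Real.cos R ^ 2 := by
    refine h2.trans ?_
    rw [div_le_div_iff₀ (by nlinarith) (by positivity)]
    linarith
  constructor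
  -- The argument yields the stronger lower bound cos R, weakened here to the stated cos² R.
  · calc Real.cos R ^ 2 ≤ 1 * Real.cos R := by nlinarith
      _ ≤ _ := by gcongr
  · calc _ ≤ 1 / Real.cos R ^ 2 * (1 / Real.cos R) := by gcongr; exact hc.le.trans hba1
      _ = _ := by field_simp

/-- The roles are reversed: D / sinh D is at most 1, and the curvature costs a factor 1/cosh² R in
the lower bound. The factor b/a lies in [1/cosh R, cosh R]. -/
theorem distortion_hyperbolic (hx₀ : x₀ ∈ space (-1) d) (he : IsFrame (-1) x₀ e) {R : ℝ}
    (hx : x ∈ closedBall (-1) x₀ R) (hy : y ∈ closedBall (-1) x₀ R)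
    (hD : 0 < distK (-1) x y) :
    1 / Real.cosh R ^ 3 ≤
        distK (-1) x y / Real.sinh (distK (-1) x y) *
          ((-1 * form (-1) x₀ y) / (-1 * form (-1) x₀ x)) ∧
      distK (-1) x y / Real.sinh (distK (-1) x y) *
          ((-1 * form (-1) x₀ y) / (-1 * form (-1) x₀ x)) ≤ Real.cosh R ^ 2 := by
  have hK : (-1 : ℝ) = 1 ∨ (-1 : ℝ) = -1 := .inr rfl
  have hc := Real.one_le_cosh R
  have hc0 := Real.cosh_pos R
  have hxs := mem_space_of_mem_closedBall hK hx₀ hx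
  have hys := mem_space_of_mem_closedBall hK hx₀ hy
  obtain ⟨ha1, ha2⟩ := form_mem_Icc_of_mem_closedBall_hyperbolic hx₀ hx
  obtain ⟨hb1, hb2⟩ := form_mem_Icc_of_mem_closedBall_hyperbolic hx₀ hy
  have hcos := cosK_distK hK hxs hys
  rw [cosK, if_pos (by norm_num)] at hcos
  have habs := abs_form_sub_mul_le (c := Real.cosh R ^ 2 - 1) hK hx₀ he hxs hys
    (one_pos.trans_le ha1) (one_pos.trans_le hb1) (by nlinarith) (by nlinarith)
  rw [← hcos] at habs
  set a := -1 * form (-1) x₀ x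
  set b := -1 * form (-1) x₀ y
  set D := distK (-1) x y
  -- With c = sinh² R, cosh D ≤ ab + sinh² R ≤ 2cosh² R - 1 = cosh 2R.
  have hcosD : 1 + Real.cosh D ≤ 2 * Real.cosh R ^ 2 := by
    nlinarith [(abs_le.1 habs).2,
      mul_le_mul ha2 hb2 (zero_le_one.trans hb1) (zero_le_one.trans (ha1.trans ha2))]
  obtain ⟨h1, h2⟩ := div_sinh_bounds hD
  have ha0 : 0 < a := one_pos.trans_le ha1
  have hba1 : 1 / Real.cosh R ≤ b / a := div_le_div₀ (zero_le_one.trans hb1) hb1 ha0 ha2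
  have hba2 : b / a ≤ Real.cosh R := by
    rw [div_le_iff₀ ha0]; nlinarith
  have h3 : 1 / Real.cosh R ^ 2 ≤ D / Real.sinh D := by
    refine le_trans ?_ h1
    rw [div_le_div_iff₀ (by positivity) (by positivity)]
    linarith
  constructor
  · calc 1 / Real.cosh R ^ 3 = 1 / Real.cosh R ^ 2 * (1 / Real.cosh R) := by field_simp
      _ ≤ _ := by gcongr
  -- The bound obtained is cosh R; the stated cosh² R is weaker.
  · calc _ ≤ 1 * Real.cosh R := by gcongr
      _ ≤ _ := by nlinarith

theorem distortion (hK : K = 1 ∨ K = -1) (hx₀ : x₀ ∈ space K d) (he : IsFrame K x₀ e) {R : ℝ}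
    (hR : 0 ≤ R) (hRK : K = 1 → R < Real.pi / 2) (hx : x ∈ closedBall K x₀ R)
    (hy : y ∈ closedBall K x₀ R) (hD : 0 < distK K x y) :
    gammaP K R ≤ distK K x y / sinK K (distK K x y) * ((K * form K x₀ y) / (K * form K x₀ x)) ∧
      distK K x y / sinK K (distK K x y) * ((K * form K x₀ y) / (K * form K x₀ x)) ≤
        1 / gammaN K R := by
  rcases hK with rfl | rfl
  · simpa [gammaP, gammaN, sinK, show ¬ ((1 : ℝ) < 0) by norm_num] using
      distortion_sphere hx₀ he hR (hRK rfl) hx hy hD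
  · simpa [gammaP, gammaN, sinK] using distortion_hyperbolic hx₀ he hx hy hD

/-- The inner products of the gradients upstairs and downstairs with the displacements agree up
to a factor in `[gammaP K R, 1 / gammaN K R]`. -/
theorem exists_form_grad_logMap_eq_mul (hK : K = 1 ∨ K = -1) (hx₀ : x₀ ∈ space K d)
    (he : IsFrame K x₀ e) {R : ℝ} (hR : 0 ≤ R) (hRK : K = 1 → R < Real.pi / 2)
    {F : Ambient d → ℝ} (hx : x ∈ closedBall K x₀ R) (hy : y ∈ closedBall K x₀ R)
    (hF : DifferentiableWithinAt ℝ F (space K d) x) :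
    ∃ c, gammaP K R ≤ c ∧ c ≤ 1 / gammaN K R ∧
      form K (grad K F x) (logMap K x y) =
        c * inner ℝ (gradient (F ∘ geodesicMapInv K x₀ e) (geodesicMap K x₀ e x))
          (geodesicMap K x₀ e y - geodesicMap K x₀ e x) := by
  have hxs := mem_space_of_mem_closedBall hK hx₀ hx
  have hys := mem_space_of_mem_closedBall hK hx₀ hy
  have hg := hasGradAt_grad hK hxs hF
  have ha := form_pos_of_mem_closedBall hK hx₀ hR hRK hx
  have hb := form_pos_of_mem_closedBall hK hx₀ hR hRK hy
  rcases (distK_nonneg hK hxs hys).eq_or_lt with h0 | hD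
  -- For y = x both slopes vanish and any factor works. The general formula is unusable, since D /
  -- sinK D is then 0/0, which evaluates to 0; the value 1 lies in the required interval.
  · have hp1 := (gammaP_mem_Ioc hK hR hRK).2
    obtain ⟨hn, hn1⟩ := gammaN_mem_Ioc hK hR hRK
    refine ⟨1, hp1, (one_le_div hn).2 hn1, ?_⟩
    rw [form_logMap hg.1, ← h0, eq_of_distK_eq_zero hK hxs hys h0.symm]
    simp
  · obtain ⟨h1, h2⟩ := distortion hK hx₀ he hR hRK hx hy hD
    refine ⟨_, h1, h2, ?_⟩
    rw [form_logMap hg.1, inner_gradient_comp_geodesicMapInv hK hx₀ he hxs ha hys hb hg]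
    set a := K * form K x₀ x
    set b := K * form K x₀ y
    field_simp

end Distortion

end SpaceForm

theorem mainTheorem7 (d : ℕ) (K : ℝ) (hK : K = 1 ∨ K = -1)
    (x₀ : SpaceForm.Ambient d) (hx₀ : x₀ ∈ SpaceForm.space K d)
    (e : Fin d → SpaceForm.Ambient d) (he : SpaceForm.IsFrame K x₀ e)
    (R : ℝ) (hR : 0 ≤ R) (hRK : K = 1 → R < Real.pi / 2)
    (M : Set (SpaceForm.Ambient d)) (hM : M = SpaceForm.closedBall K x₀ R)
    (F : SpaceForm.Ambient d → ℝ)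
    (hF : ∀ x ∈ M, DifferentiableWithinAt ℝ F (SpaceForm.space K d) x)
    (h : SpaceForm.Ambient d → EuclideanSpace ℝ (Fin d)) (hh : h = SpaceForm.geodesicMap K x₀ e)
    (f : EuclideanSpace ℝ (Fin d) → ℝ) (hf : f = F ∘ SpaceForm.geodesicMapInv K x₀ e) :
    (0 < SpaceForm.gammaP K R ∧ SpaceForm.gammaP K R ≤ 1) ∧
    (0 < SpaceForm.gammaN K R ∧ SpaceForm.gammaN K R ≤ 1) ∧
    (∀ x ∈ M, DifferentiableAt ℝ f (h x)) ∧
    (∀ x ∈ M, ∀ y ∈ M, inner ℝ (gradient f (h x)) (h y - h x) ≠ 0 →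
      SpaceForm.gammaP K R ≤
          SpaceForm.form K (SpaceForm.grad K F x) (SpaceForm.logMap K x y) /
            inner ℝ (gradient f (h x)) (h y - h x) ∧
        SpaceForm.form K (SpaceForm.grad K F x) (SpaceForm.logMap K x y) /
            inner ℝ (gradient f (h x)) (h y - h x) ≤ 1 / SpaceForm.gammaN K R) ∧
    (SpaceForm.GConvexOn K M F →
      ∀ x ∈ M, ∀ y ∈ M,
        (inner ℝ (gradient f (h x)) (h y - h x) ≤ 0 →
          f (h x) + 1 / SpaceForm.gammaN K R * inner ℝ (gradient f (h x)) (h y - h x) ≤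
            f (h y)) ∧
        (0 ≤ inner ℝ (gradient f (h x)) (h y - h x) →
          f (h x) + SpaceForm.gammaP K R * inner ℝ (gradient f (h x)) (h y - h x) ≤
            f (h y))) := by
  subst hM hh hf
  have key := fun x hx y hy => SpaceForm.exists_form_grad_logMap_eq_mul (y := y) hK hx₀ he hR hRK
    hx hy (hF x hx)
  have hpos := fun x hx => SpaceForm.form_pos_of_mem_closedBall (x := x) hK hx₀ hR hRK hx
  have hsp := fun x hx => SpaceForm.mem_space_of_mem_closedBall (x := x) (R := R) hK hx₀ hx
  refine ⟨SpaceForm.gammaP_mem_Ioc hK hR hRK, SpaceForm.gammaN_mem_Ioc hK hR hRK, ?_, ?_, ?_⟩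
  · intro x hx
    obtain ⟨L, -, hL⟩ := SpaceForm.hasFDerivAt_comp_geodesicMapInv hK hx₀ he (hsp x hx)
      (hpos x hx) (SpaceForm.hasGradAt_grad hK (hsp x hx) (hF x hx))
    exact hL.differentiableAt
  · intro x hx y hy hne
    obtain ⟨c, h1, h2, h3⟩ := key x hx y hy
    rw [h3, mul_div_cancel_right₀ _ hne]
    exact ⟨h1, h2⟩
  · intro hconv x hx y hy
    obtain ⟨c, h1, h2, h3⟩ := key x hx y hy
    have h4 := hconv x hx y hy
    rw [h3] at h4
    rw [Function.comp_apply, Function.comp_apply,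
      SpaceForm.geodesicMapInv_geodesicMap hK hx₀ he (hsp x hx) (hpos x hx),
      SpaceForm.geodesicMapInv_geodesicMap hK hx₀ he (hsp y hy) (hpos y hy)]
    constructor
    -- For a nonpositive slope, enlarging the factor c to 1/γₙ lowers the product; for a nonnegative
    -- slope, shrinking c to γₚ does.
    · intro h5
      linarith [mul_le_mul_of_nonpos_right h2 h5]
    · intro h5
      linarith [mul_le_mul_of_nonneg_right h1 h5]
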